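/- Let $M$ be a connected smooth manifold of dimension $m$ and let $\varphi : M \to \mathbb{S}^n$ be a smooth immersion into the unit sphere of $\mathbb{R}^{n+1}$ (for instance the inclusion of a submanifold); give $M$ the induced metric $g$. Let $\nabla$ be the connection of $\varphi^* T\mathbb{S}^n$ induced by the Levi-Civita connection of $\mathbb{S}^n$, $B$ the second fundamental form, $H = \frac1m \operatorname{tr}_g B$ the mean curvature vector, and $A$ the Weingarten operator, so that $A_X V$ is minus the tangential part of $\nabla_V X$ for a normal field $X$. Let $\delta T\varphi = -\operatorname{tr}_g \nabla T\varphi = -mH$, let $\Delta = -\operatorname{tr}_g \nabla^2$ be the rough Laplacian on sections of $\varphi^*T\mathbb{S}^n$, and let $S(X) = \operatorname{tr}_g R_{X,T\varphi}T\varphi$, where $R_{X,Y} = \nabla_X\nabla_Y - \nabla_Y\nabla_X - \nabla_{[X,Y]}$ is the curvature tensor of $\mathbb{S}^n$. Suppose that $M$ is pseudo-umbilical, i.e. $A_H = |H|^2\,\mathrm{Id}_{TM}$, and that, for some real number $k$, $M$ is biharmonic of index $k$ in $\mathbb{S}^n$, i.e. $$\Delta\, \delta T\varphi - S(\delta T\varphi)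 + k\,\delta T\varphi = 0.$$ If $m \neq 4$, then $|H|$ is constant on $M$. -/

import Mathlib

open scoped Manifold ContDiff

noncomputable section

namespace SphereSubmanifold

/-- The Euclidean space `ℝⁿ⁺¹` that contains the unit sphere `𝕊ⁿ`. -/
abbrev Ambient (n : ℕ) : Type := EuclideanSpace ℝ (Fin (n + 1))

/-- The unit sphere `𝕊ⁿ ⊂ ℝⁿ⁺¹`. -/
abbrev UnitSphere (n : ℕ) : Type := Metric.sphere (0 : Ambient n) 1

section Sphere

variable {n : ℕ}

/-- Orthogonal projection of `ℝⁿ⁺¹` onto `y^⊥`; for `y ∈ 𝕊ⁿ` this is the tangent space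
`T_y 𝕊ⁿ`. -/
def sphereProj (y : Ambient n) : Ambient n →L[ℝ] Ambient n :=
  (Submodule.span ℝ {y})ᗮ.starProjection

/-- The Levi-Civita connection of `𝕊ⁿ`: the tangential part at `y` of the derivative of the
vector field `Z` in the direction `u`. -/
def sphereNabla (Z : Ambient n → Ambient n) (y u : Ambient n) : Ambient n :=
  sphereProj y (fderiv ℝ Z y u)

/-- The curvature tensor `R_{a,b} c = ∇_a ∇_b c - ∇_b ∇_a c - ∇_[a,b] c` of `𝕊ⁿ` at `y`. The
vectors `a, b, c`, tangent to `𝕊ⁿ` at `y`, are extended to the vector fields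
`z ↦ sphereProj z a`, etc., which are tangent to `𝕊ⁿ`. -/
def sphereCurvature (y a b c : Ambient n) : Ambient n :=
  sphereNabla (fun z => sphereNabla (fun x => sphereProj x c) z (sphereProj z b)) y a
    - sphereNabla (fun z => sphereNabla (fun x => sphereProj x c) z (sphereProj z a)) y b
    - sphereNabla (fun x => sphereProj x c) y
        (VectorField.lieBracket ℝ (fun z => sphereProj z a) (fun z => sphereProj z b) y)

end Sphere

section Immersion

variable (m : ℕ) {n : ℕ} {M : Type*} [TopologicalSpace M] [ChartedSpace (EuclideanSpace ℝ (Fin m)) M]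

/-- The differential at `p` of `φ : M → 𝕊ⁿ ⊂ ℝⁿ⁺¹`, with values in `ℝⁿ⁺¹`. -/
def differential (φ : M → UnitSphere n) (p : M) : TangentSpace (𝓡 m) p →L[ℝ] Ambient n :=
  mvfderiv (𝓡 m) (fun q => (φ q : Ambient n)) p

/-- The tangent space of the (immersed) submanifold at `p`, as a subspace of `ℝⁿ⁺¹`. It carries the
induced metric. Tangent vectors of `M` at `p` are identified with their images in it. -/
def tangentSpaceIn (φ : M → UnitSphere n) (p : M) : Submodule ℝ (Ambient n) :=
  (differential m φ p).range

/-- The normal space of the submanifold at `p`: the orthogonal complement of its tangent space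
in `T_{φ p} 𝕊ⁿ`. -/
def normalSpaceIn (φ : M → UnitSphere n) (p : M) : Submodule ℝ (Ambient n) :=
  (tangentSpaceIn m φ p)ᗮ ⊓ (Submodule.span ℝ {(φ p : Ambient n)})ᗮ

/-- The tangent vector of `M` at `p` that corresponds to the vector `v` of `tangentSpaceIn m φ p`. -/
def tangentVector (φ : M → UnitSphere n) (p : M) (v : Ambient n) : TangentSpace (𝓡 m) p :=
  haveI : Nonempty (TangentSpace (𝓡 m) p) := ⟨0⟩
  Function.invFun (differential m φ p) v

/-- The connection `∇` of `φ^* T𝕊ⁿ`: covariant derivative at `p`, in the direction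
`v ∈ tangentSpaceIn m φ p`, of the section `X`, seen as a map `M → ℝⁿ⁺¹`. -/
def nabla (φ : M → UnitSphere n) (X : M → Ambient n) (p : M) (v : Ambient n) : Ambient n :=
  sphereProj (φ p : Ambient n) (mvfderiv (𝓡 m) X p (tangentVector m φ p v))

/-- The Levi-Civita connection `∇^T` of the induced metric: the tangential part of `∇`. -/
def tangentNabla (φ : M → UnitSphere n) (W : M → Ambient n) (p : M) (v : Ambient n) : Ambient n :=
  (tangentSpaceIn m φ p).starProjection (nabla m φ W p v)

/-- An extension of a tangent vector `w` at a point to a vector field tangent to the submanifold.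
The tensors below are computed with this extension; they do not depend on the choice. -/
def extend (φ : M → UnitSphere n) (w : Ambient n) (q : M) : Ambient n :=
  (tangentSpaceIn m φ q).starProjection w

/-- The trace, with respect to the induced metric, of a bilinear form on the tangent space
at `p`. -/
def traceAt (φ : M → UnitSphere n) (p : M) (β : Ambient n → Ambient n → Ambient n) : Ambient n :=
  ∑ i, β (stdOrthonormalBasis ℝ (tangentSpaceIn m φ p) i : Ambient n)
    (stdOrthonormalBasis ℝ (tangentSpaceIn m φ p) i : Ambient n)

/-- The second fundamental form `B(v, w) = (∇_v w)^N`. -/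
def secondFundamentalForm (φ : M → UnitSphere n) (p : M) (v w : Ambient n) : Ambient n :=
  (normalSpaceIn m φ p).starProjection (nabla m φ (extend m φ w) p v)

/-- The mean curvature vector `H = (1/m) tr B`. -/
def meanCurvature (φ : M → UnitSphere n) (p : M) : Ambient n :=
  (m : ℝ)⁻¹ • traceAt m φ p (secondFundamentalForm m φ p)

/-- The Weingarten operator `A_X v = -(∇_v X)^T` of a section `X` of the normal bundle. -/
def weingarten (φ : M → UnitSphere n) (X : M → Ambient n) (p : M) (v : Ambient n) : Ambient n :=
  -(tangentSpaceIn m φ p).starProjection (nabla m φ X p v)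

/-- The submanifold is pseudo-umbilical: `A_H = |H|² Id`. -/
def IsPseudoUmbilical (φ : M → UnitSphere n) : Prop :=
  ∀ p : M, ∀ v ∈ tangentSpaceIn m φ p,
    weingarten m φ (meanCurvature m φ) p v = ‖meanCurvature m φ p‖ ^ 2 • v

/-- The covariant derivative of `Tφ`: `(∇ Tφ)(v, w) = ∇_v (Tφ(w)) - Tφ(∇^T_v w)`. -/
def nablaDifferential (φ : M → UnitSphere n) (p : M) (v w : Ambient n) : Ambient n :=
  nabla m φ (extend m φ w) p v - tangentNabla m φ (extend m φ w) p v

/-- The divergence `δ Tφ = -tr ∇ Tφ`, a section of `φ^* T𝕊ⁿ`. -/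
def divDifferential (φ : M → UnitSphere n) (p : M) : Ambient n :=
  -traceAt m φ p (nablaDifferential m φ p)

/-- The second covariant derivative `∇²_{v,w} X = ∇_v ∇_w X - ∇_{∇^T_v w} X` of a section `X` of
`φ^* T𝕊ⁿ`. -/
def secondNabla (φ : M → UnitSphere n) (X : M → Ambient n) (p : M) (v w : Ambient n) :
    Ambient n :=
  nabla m φ (fun q => nabla m φ X q (extend m φ w q)) p v - nabla m φ X p (tangentNabla m φ (extend m φ w) p v)

/-- The (nonnegative) rough Laplacian `Δ X = -tr ∇² X` on sections of `φ^* T𝕊ⁿ`. -/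
def roughLaplacian (φ : M → UnitSphere n) (X : M → Ambient n) (p : M) : Ambient n :=
  -traceAt m φ p (secondNabla m φ X p)

/-- The endomorphism `S(X) = tr R_{X, Tφ} Tφ` of `φ^* T𝕊ⁿ`. -/
def curvatureTrace (φ : M → UnitSphere n) (X : M → Ambient n) (p : M) : Ambient n :=
  traceAt m φ p (fun v w => sphereCurvature (φ p : Ambient n) (X p) v w)

/-- The immersion `φ : M → 𝕊ⁿ`, with the induced metric on `M`, is biharmonic of index `k`:
`Δ δTφ - S(δTφ) + k δTφ = 0`. -/
def IsBiharmonicOfIndex (k : ℝ) (φ : M → UnitSphere n) : Prop :=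
  ∀ p : M, roughLaplacian m φ (divDifferential m φ) p - curvatureTrace m φ (divDifferential m φ) p
    + k • divDifferential m φ p = 0

end Immersion

end SphereSubmanifold

end

/-! Write f for φ in a chart, P for the projection onto the tangent spaces of f in ℝⁿ⁺¹, τ = mH and
λ = |τ|²/m. In the sphere R_{X,e}e is normal when X is normal and e is tangent, so S(τ) and kτ are
both normal, and the tangential part of the biharmonic equation says that tr ∇²τ has no tangential
part. Pseudo-umbilicity, rescaled from H to τ, reads P(Dτ ξ) = -λ Df ξ. Differentiating this along a
tangent basis and applying Codazzi gives the tangential part of tr ∇²τ as (m/2 - 2) grad λ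
(`sum_inner_fderiv_fderiv_pullback`). Hence dλ = 0 when m ≠ 4, and connectedness makes |H| constant.

All extrinsic geometry is read off the self-adjoint operators DP(ξ): on tangent vectors DP is the
second fundamental form in ℝⁿ⁺¹, on normal vectors it is the shape operator. Gauss and Codazzi
become derivatives of identities such as P Df = Df and Pτ = 0, with no local frames. The remaining
work identifies the invariant definitions on M with these chart expressions. -/

section
open scoped InnerProductSpace

/-! ### Linear algebra: pseudo-inverses, projections and traces. -/

namespace ImmersionChart

variable {E V : Type*} [NormedAddCommGroup E] [InnerProductSpace ℝ E] [FiniteDimensional ℝ E]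
  [NormedAddCommGroup V] [InnerProductSpace ℝ V] [FiniteDimensional ℝ V]

/-- The Moore–Penrose inverse `(Aᵀ A)⁻¹ Aᵀ` of an injective linear map `A`. -/
noncomputable def leftInv (A : E →L[ℝ] V) : V →L[ℝ] E :=
  (A.adjoint ∘L A).inverse ∘L A.adjoint

/-- If AᵀA x = 0 then |Ax|² = ⟪AᵀA x, x⟫ = 0, so the Gram operator is injective, hence invertible in
finite dimension. -/
lemma exists_equiv_gram {A : E →L[ℝ] V} (hA : Function.Injective A) :
    ∃ e : E ≃L[ℝ] E, (e : E →L[ℝ] E) = A.adjoint ∘L A := by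
  have hinj : Function.Injective ((A.adjoint ∘L A : E →L[ℝ] E) : E →ₗ[ℝ] E) := by
    rw [← LinearMap.ker_eq_bot, LinearMap.ker_eq_bot']
    intro x hx
    apply hA
    rw [map_zero, ← inner_self_eq_zero (𝕜 := ℝ), ← ContinuousLinearMap.adjoint_inner_left]
    have : A.adjoint (A x) = 0 := hx
    rw [this, inner_zero_left]
  refine ⟨(LinearEquiv.ofInjectiveEndo _ hinj).toContinuousLinearEquiv, ?_⟩
  ext x
  rfl

lemma leftInv_apply {A : E →L[ℝ] V} (hA : Function.Injective A) (x : E) : leftInv A (A x) = x := by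
  obtain ⟨e, he⟩ := exists_equiv_gram hA
  have h1 : A.adjoint (A x) = e x := by rw [← ContinuousLinearEquiv.coe_coe, he]; rfl
  simp [leftInv, ← he, h1]

lemma apply_leftInv {A : E →L[ℝ] V} (hA : Function.Injective A) (v : V) :
    A (leftInv A v) = A.range.starProjection v := by
  symm
  apply Submodule.eq_starProjection_of_mem_of_inner_eq_zero
  · exact ⟨_, rfl⟩
  · rintro _ ⟨x, rfl⟩
    obtain ⟨e, he⟩ := exists_equiv_gram hA
    have h1 (y : E) : A.adjoint (A y) = e y := by rw [← ContinuousLinearEquiv.coe_coe, he]; rfl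
    simp only [ContinuousLinearMap.coe_coe]
    rw [← ContinuousLinearMap.adjoint_inner_left, map_sub, h1]
    simp [leftInv, ← he]

/-- Operator inversion is smooth at invertible operators. The smooth dependence of tangent
projections on the base point rests on this. -/
lemma contDiffAt_leftInv {A : E →L[ℝ] V} (hA : Function.Injective A) :
    ContDiffAt ℝ ∞ (leftInv : (E →L[ℝ] V) → (V →L[ℝ] E)) A := by
  obtain ⟨e, he⟩ := exists_equiv_gram hA
  have hadj : ContDiff ℝ ∞ (fun A : E →L[ℝ] V => A.adjoint) :=
    (ContinuousLinearMap.adjoint (𝕜 := ℝ) (E := E) (F := V)).toContinuousLinearEquiv.contDiff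
  have hg : ContDiffAt ℝ ∞ (fun A : E →L[ℝ] V => A.adjoint ∘L A) A :=
    (hadj.clm_comp contDiff_id).contDiffAt
  have hi : ContDiffAt ℝ ∞ (ContinuousLinearMap.inverse : (E →L[ℝ] E) → (E →L[ℝ] E))
      (A.adjoint ∘L A) := by
    rw [← he]; exact contDiffAt_map_inverse e
  exact (ContDiffAt.comp (f := fun A : E →L[ℝ] V => A.adjoint ∘L A) A hi hg).clm_comp
    hadj.contDiffAt

/-- The trace of a bilinear form over an orthonormal basis of a subspace, computed in an orthonormal
basis of the whole space. -/
lemma sum_orthonormalBasis_submodule {ι κ W : Type*} [Fintype ι] [Fintype κ] [AddCommGroup W]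
    [Module ℝ W] {T : Submodule ℝ V} (e : OrthonormalBasis ι ℝ T) (b : OrthonormalBasis κ ℝ V)
    (β : V →ₗ[ℝ] V →ₗ[ℝ] W) :
    ∑ i, β (e i) (e i) = ∑ j, β (T.starProjection (b j)) (b j) := by
  have hP (v : V) : T.starProjection v = ∑ i, ⟪(e i : V), v⟫_ℝ • (e i : V) := by
    rw [Submodule.starProjection_apply, ← e.sum_repr' (T.orthogonalProjectionOnto v)]
    simp only [Submodule.coe_sum, Submodule.coe_smul]
    refine Finset.sum_congr rfl fun i _ => ?_
    rw [Submodule.coe_inner, ← Submodule.starProjection_apply,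
      ← Submodule.inner_starProjection_left_eq_right,
      Submodule.starProjection_eq_self_iff.2 (e i).2]
  simp only [hP, map_sum, LinearMap.sum_apply, map_smul, LinearMap.smul_apply]
  rw [Finset.sum_comm]
  refine Finset.sum_congr rfl fun i _ => ?_
  conv_lhs => arg 2; rw [← b.sum_repr' (e i : V)]
  simp only [map_sum, LinearMap.map_smul]
  exact Finset.sum_congr rfl fun j _ => by rw [real_inner_comm]

end ImmersionChart
end

/-! ### Extrinsic geometry of an immersion through the derivative of its tangent projection. -/

section
open scoped InnerProductSpace Topology

namespace ImmersionChart

set_option linter.unusedSectionVars false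

variable {E V : Type*} [NormedAddCommGroup E] [InnerProductSpace ℝ E] [FiniteDimensional ℝ E]
  [NormedAddCommGroup V] [InnerProductSpace ℝ V] [FiniteDimensional ℝ V]

/-- The orthogonal projection onto the tangent space of an immersion `f` at `f x`. -/
noncomputable def tangentProj (f : E → V) (x : E) : V →L[ℝ] V := (fderiv ℝ f x).range.starProjection

/-- The vector of the parameter domain which an immersion `f` maps to a given tangent vector. -/
noncomputable def pullback (f : E → V) (x : E) : V →L[ℝ] E := leftInv (fderiv ℝ f x)

variable {f τ : E → V} {U : Set E} {x : E}

lemma inner_tangentProj_left (v w : V) :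
    ⟪tangentProj f x v, w⟫_ℝ = ⟪v, tangentProj f x w⟫_ℝ :=
  Submodule.inner_starProjection_left_eq_right _ _ _

lemma tangentProj_fderiv (ξ : E) : tangentProj f x (fderiv ℝ f x ξ) = fderiv ℝ f x ξ :=
  Submodule.starProjection_eq_self_iff.2 ⟨ξ, rfl⟩

lemma contDiffOn_fderiv {F : Type*} [NormedAddCommGroup F] [NormedSpace ℝ F] {g : E → F}
    (hU : IsOpen U) (hg : ContDiffOn ℝ ∞ g U) : ContDiffOn ℝ ∞ (fderiv ℝ g) U := hg.fderiv_of_isOpen hU (by simp)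

lemma contDiffOn_pullback (hU : IsOpen U) (hf : ContDiffOn ℝ ∞ f U)
    (hinj : ∀ y ∈ U, Function.Injective (fderiv ℝ f y)) : ContDiffOn ℝ ∞ (pullback f) U :=
  fun y hy => (contDiffAt_leftInv (hinj y hy)).comp_contDiffWithinAt y (contDiffOn_fderiv hU hf y hy)

lemma contDiffOn_tangentProj (hU : IsOpen U) (hf : ContDiffOn ℝ ∞ f U)
    (hinj : ∀ y ∈ U, Function.Injective (fderiv ℝ f y)) : ContDiffOn ℝ ∞ (tangentProj f) U := by
  refine ((contDiffOn_fderiv hU hf).clm_comp (contDiffOn_pullback hU hf hinj)).congr fun y hy => ?_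
  ext1 v
  exact (apply_leftInv (hinj y hy) v).symm

lemma differentiableAt_of_contDiffOn {F : Type*} [NormedAddCommGroup F] [NormedSpace ℝ F]
    {g : E → F} (hU : IsOpen U) (hg : ContDiffOn ℝ ∞ g U) (hx : x ∈ U) : DifferentiableAt ℝ g x :=
  (hg.contDiffAt (hU.mem_nhds hx)).differentiableAt (by simp)

lemma fderiv_eq_of_eqOn {F : Type*} [NormedAddCommGroup F] [NormedSpace ℝ F] {g h : E → F}
    (hU : IsOpen U) (hx : x ∈ U) (hgh : ∀ y ∈ U, g y = h y) : fderiv ℝ g x = fderiv ℝ h x :=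
  Filter.EventuallyEq.fderiv_eq (Filter.mem_of_superset (hU.mem_nhds hx) hgh)

lemma fderiv_fderiv_comm {F : Type*} [NormedAddCommGroup F] [NormedSpace ℝ F] {g : E → F}
    (hU : IsOpen U) (hg : ContDiffOn ℝ ∞ g U) (hx : x ∈ U) (ξ η : E) :
    fderiv ℝ (fderiv ℝ g) x ξ η = fderiv ℝ (fderiv ℝ g) x η ξ :=
  (hg.contDiffAt (hU.mem_nhds hx)).isSymmSndFDerivAt (by simp; exact WithTop.coe_le_coe.2 (le_top : (2 : ℕ∞) ≤ ⊤)) ξ η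

section

variable (hU : IsOpen U) (hf : ContDiffOn ℝ ∞ f U)
  (hinj : ∀ y ∈ U, Function.Injective (fderiv ℝ f y)) (hx : x ∈ U)
include hU hf hinj hx

/-- Differentiate P(Df η) = Df η. The right-hand side is the normal part of D²f, that is, the second
fundamental form in the ambient space. -/
lemma fderiv_tangentProj_fderiv (ξ η : E) :
    fderiv ℝ (tangentProj f) x ξ (fderiv ℝ f x η)
      = fderiv ℝ (fderiv ℝ f) x ξ η - tangentProj f x (fderiv ℝ (fderiv ℝ f) x ξ η) := by
  have dP := differentiableAt_of_contDiffOn hU (contDiffOn_tangentProj hU hf hinj) hx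
  have dJ := differentiableAt_of_contDiffOn hU (contDiffOn_fderiv hU hf) hx
  have h := fderiv_eq_of_eqOn (g := fun y => tangentProj f y (fderiv ℝ f y η))
    (h := fun y => fderiv ℝ f y η) hU hx fun y _ => tangentProj_fderiv η
  rw [fderiv_clm_apply dP (by fun_prop), fderiv_clm_apply dJ (by fun_prop)] at h
  have h' := DFunLike.congr_fun h ξ
  simp at h'
  exact eq_sub_of_add_eq' h'

lemma fderiv_tangentProj_comm (ξ η : E) :
    fderiv ℝ (tangentProj f) x ξ (fderiv ℝ f x η) = fderiv ℝ (tangentProj f) x η (fderiv ℝ f x ξ) := by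
  rw [fderiv_tangentProj_fderiv hU hf hinj hx, fderiv_tangentProj_fderiv hU hf hinj hx,
    fderiv_fderiv_comm hU hf hx]

lemma tangentProj_fderiv_tangentProj (ξ η : E) :
    tangentProj f x (fderiv ℝ (tangentProj f) x ξ (fderiv ℝ f x η)) = 0 := by
  rw [fderiv_tangentProj_fderiv hU hf hinj hx, map_sub, sub_eq_zero]
  exact (Submodule.starProjection_eq_self_iff.2 (Submodule.starProjection_apply_mem _ _)).symm

lemma inner_fderiv_tangentProj_left (ξ : E) (v w : V) :
    ⟪fderiv ℝ (tangentProj f) x ξ v, w⟫_ℝ = ⟪v, fderiv ℝ (tangentProj f) x ξ w⟫_ℝ := by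
  have dP := differentiableAt_of_contDiffOn hU (contDiffOn_tangentProj hU hf hinj) hx
  have h := congrArg (fun L => L ξ) (fderiv_eq_of_eqOn (g := fun y => ⟪tangentProj f y v, w⟫_ℝ)
    (h := fun y => ⟪v, tangentProj f y w⟫_ℝ) hU hx fun y _ => inner_tangentProj_left v w)
  beta_reduce at h
  rw [fderiv_inner_apply ℝ (by fun_prop) (by fun_prop), fderiv_inner_apply ℝ (by fun_prop) (by fun_prop),
    fderiv_clm_apply dP (by fun_prop), fderiv_clm_apply dP (by fun_prop)] at h
  simpa using h

variable (hτ : ContDiffOn ℝ ∞ τ U) {lam : E → ℝ} (hlam : ContDiffOn ℝ ∞ lam U)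
  (hnormal : ∀ y ∈ U, tangentProj f y (τ y) = 0)
  (hshape : ∀ y ∈ U, ∀ ξ, tangentProj f y (fderiv ℝ τ y ξ) = -(lam y • fderiv ℝ f y ξ))
include hτ hnormal hshape

/-- Differentiating Pτ = 0 gives DP(ξ)τ = -P(Dτ ξ): on normal vectors, DP is the shape operator. -/
lemma fderiv_tangentProj_normal (ξ : E) :
    fderiv ℝ (tangentProj f) x ξ (τ x) = lam x • fderiv ℝ f x ξ := by
  have dP := differentiableAt_of_contDiffOn hU (contDiffOn_tangentProj hU hf hinj) hx
  have dτ := differentiableAt_of_contDiffOn hU hτ hx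
  have h := congrArg (fun L => L ξ) (fderiv_eq_of_eqOn (g := fun y => tangentProj f y (τ y))
    (h := fun y => 0) hU hx hnormal)
  beta_reduce at h
  rw [fderiv_clm_apply dP dτ] at h
  simp [hshape x hx] at h
  exact neg_add_eq_zero.1 h |>.symm

include hlam

/-- The Codazzi equation for a normal field whose shape operator is a multiple of the identity. -/
lemma fderiv_tangentProj_fderiv_normal_sub (ξ η : E) :
    fderiv ℝ (tangentProj f) x ξ (fderiv ℝ τ x η) - fderiv ℝ (tangentProj f) x η (fderiv ℝ τ x ξ)
      = fderiv ℝ lam x η • fderiv ℝ f x ξ - fderiv ℝ lam x ξ • fderiv ℝ f x η := by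
  have cP := contDiffOn_tangentProj hU hf hinj
  have dP' := differentiableAt_of_contDiffOn hU (contDiffOn_fderiv hU cP) hx
  have dJ := differentiableAt_of_contDiffOn hU (contDiffOn_fderiv hU hf) hx
  have dτ := differentiableAt_of_contDiffOn hU hτ hx
  have dlam := differentiableAt_of_contDiffOn hU hlam hx
  -- Differentiate DP(ξ)τ = λ Df ξ along η. On antisymmetrizing in ξ and η, the second derivatives
  -- of P and of f cancel.
  have key (ξ η : E) : fderiv ℝ (fderiv ℝ (tangentProj f)) x η ξ (τ x)
      + fderiv ℝ (tangentProj f) x ξ (fderiv ℝ τ x η)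
      = fderiv ℝ lam x η • fderiv ℝ f x ξ + lam x • fderiv ℝ (fderiv ℝ f) x η ξ := by
    have h := congrArg (fun L => L η) (fderiv_eq_of_eqOn
      (g := fun y => fderiv ℝ (tangentProj f) y ξ (τ y)) (h := fun y => lam y • fderiv ℝ f y ξ)
      hU hx fun y hy => fderiv_tangentProj_normal hU hf hinj hy hτ hnormal hshape ξ)
    beta_reduce at h
    rw [fderiv_clm_apply (by fun_prop) dτ, fderiv_clm_apply dP' (by fun_prop),
      fderiv_fun_smul dlam (by fun_prop), fderiv_clm_apply dJ (by fun_prop)] at h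
    simp at h
    rw [add_comm, h, add_comm]
  have h1 := key ξ η
  have h2 := key η ξ
  rw [fderiv_fderiv_comm hU cP hx, fderiv_fderiv_comm hU hf hx] at h1
  rw [eq_sub_of_add_eq' h1, eq_sub_of_add_eq' h2]
  abel

/-- Differentiate P(Dτ(a w)) = -λ P w along a w, where a is the pullback, and pair with the tangent
vector Df ζ. -/
lemma inner_fderiv_fderiv_pullback (w : V) (hw : tangentProj f x w = w) (ζ : E) :
    ⟪fderiv ℝ (fun y => fderiv ℝ τ y (pullback f y w)) x (pullback f x w), fderiv ℝ f x ζ⟫_ℝ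
      = -(fderiv ℝ lam x (pullback f x w) * ⟪w, fderiv ℝ f x ζ⟫_ℝ)
        - ⟪fderiv ℝ (tangentProj f) x ζ (fderiv ℝ τ x (pullback f x w)), w⟫_ℝ := by
  have dP := differentiableAt_of_contDiffOn hU (contDiffOn_tangentProj hU hf hinj) hx
  have da := differentiableAt_of_contDiffOn hU (contDiffOn_pullback hU hf hinj) hx
  have dJ := differentiableAt_of_contDiffOn hU (contDiffOn_fderiv hU hf) hx
  have dτ' := differentiableAt_of_contDiffOn hU (contDiffOn_fderiv hU hτ) hx
  have dlam := differentiableAt_of_contDiffOn hU hlam hx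
  have hJa : fderiv ℝ f x (pullback f x w) = w := (apply_leftInv (hinj x hx) w).trans hw
  have h := congrArg (fun L => ⟪L (pullback f x w), fderiv ℝ f x ζ⟫_ℝ) (fderiv_eq_of_eqOn
      (g := fun y => tangentProj f y (fderiv ℝ τ y (pullback f y w)))
      (h := fun y => -(lam y • tangentProj f y w))
      hU hx fun y hy => by
        rw [hshape y hy]
        exact congrArg (fun v => -(lam y • v)) (apply_leftInv (hinj y hy) w))
  beta_reduce at h
  rw [fderiv_clm_apply dP (by fun_prop), fderiv_fun_neg, fderiv_fun_smul dlam (by fun_prop),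
    fderiv_clm_apply dP (by fun_prop)] at h
  simp only [add_apply, ContinuousLinearMap.comp_apply,
    ContinuousLinearMap.flip_apply, neg_apply, smul_apply,
    ContinuousLinearMap.smulRight_apply, inner_add_left, inner_neg_left, inner_smul_left,
    inner_tangentProj_left, tangentProj_fderiv, hw] at h
  -- DP maps tangent vectors to normal ones, so differentiating the projection of `w` contributes
  -- nothing.
  have h0 : ⟪fderiv ℝ (tangentProj f) x (pullback f x w) w, fderiv ℝ f x ζ⟫_ℝ = 0 := by
    have h1 := tangentProj_fderiv_tangentProj hU hf hinj hx (pullback f x w) (pullback f x w)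
    rw [hJa] at h1
    rw [← tangentProj_fderiv, ← inner_tangentProj_left, h1, inner_zero_left]
  -- Self-adjointness of DP and its symmetry on tangent vectors exchange the roles of `w` and `ζ`.
  have h2 : ⟪fderiv ℝ (tangentProj f) x (pullback f x w) (fderiv ℝ τ x (pullback f x w)),
      fderiv ℝ f x ζ⟫_ℝ
      = ⟪fderiv ℝ (tangentProj f) x ζ (fderiv ℝ τ x (pullback f x w)), w⟫_ℝ := by
    rw [inner_fderiv_tangentProj_left hU hf hinj hx, fderiv_tangentProj_comm hU hf hinj hx, hJa,
      ← inner_fderiv_tangentProj_left hU hf hinj hx]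
  rw [h0, h2] at h
  simp at h
  linarith

/-- The tangential part of `tr ∇²τ`, for the mean curvature vector `τ` of a pseudo-umbilical
immersion in the sphere. -/
lemma sum_inner_fderiv_fderiv_pullback {ι : Type*} [Fintype ι]
    (e : OrthonormalBasis ι ℝ (fderiv ℝ f x).range) {m : ℕ} (hm : m ≠ 0) (hι : Fintype.card ι = m)
    (hlam' : ∀ y ∈ U, lam y = ‖τ y‖ ^ 2 / m)
    (hmean : ∑ i, fderiv ℝ (tangentProj f) x (pullback f x (e i)) (e i) = τ x - (m : ℝ) • f x)
    (hperp : ∀ ξ, ⟪fderiv ℝ τ x ξ, f x⟫_ℝ = 0) (ζ : E) :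
    ∑ i, ⟪fderiv ℝ (fun y => fderiv ℝ τ y (pullback f y (e i))) x (pullback f x (e i)),
        fderiv ℝ f x ζ⟫_ℝ = ((m : ℝ) / 2 - 2) * fderiv ℝ lam x ζ := by
  have hP (i : ι) : tangentProj f x (e i) = e i := Submodule.starProjection_eq_self_iff.2 (e i).2
  have hJa (i : ι) : fderiv ℝ f x (pullback f x (e i)) = e i :=
    (apply_leftInv (hinj x hx) _).trans (hP i)
  have hsum : ∑ i, fderiv ℝ lam x (pullback f x (e i)) * ⟪(e i : V), fderiv ℝ f x ζ⟫_ℝ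
      = fderiv ℝ lam x ζ := by
    have h1 := e.sum_repr' (⟨fderiv ℝ f x ζ, ζ, rfl⟩ : (fderiv ℝ f x).range)
    have h2 := congrArg (fun v : (fderiv ℝ f x).range => fderiv ℝ lam x (pullback f x v)) h1
    have h3 : pullback f x (fderiv ℝ f x ζ) = ζ := leftInv_apply (hinj x hx) ζ
    simp only [Submodule.coe_sum, Submodule.coe_smul, map_sum, map_smul, h3, Submodule.coe_inner,
      smul_eq_mul] at h2
    rw [← h2]
    exact Finset.sum_congr rfl fun i _ => mul_comm _ _
  -- Codazzi for `ζ` and the pullback of `e i`, paired with `e i`. The last term comes from |e i| =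
  -- 1 and sums to -m dλ(ζ).
  have hcod (i : ι) : ⟪fderiv ℝ (tangentProj f) x ζ (fderiv ℝ τ x (pullback f x (e i))), (e i : V)⟫_ℝ
      = ⟪fderiv ℝ τ x ζ, fderiv ℝ (tangentProj f) x (pullback f x (e i)) (e i)⟫_ℝ
        + fderiv ℝ lam x (pullback f x (e i)) * ⟪(e i : V), fderiv ℝ f x ζ⟫_ℝ
        - fderiv ℝ lam x ζ := by
    have h := congrArg (fun v => ⟪v, (e i : V)⟫_ℝ) (fderiv_tangentProj_fderiv_normal_sub hU hf hinj hx
      hτ hlam hnormal hshape ζ (pullback f x (e i)))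
    have h1 : ⟪(e i : V), (e i : V)⟫_ℝ = 1 := by
      rw [← Submodule.coe_inner, real_inner_self_eq_norm_sq, e.orthonormal.1 i]; norm_num
    simp only [inner_sub_left, inner_smul_left, hJa, h1, conj_trivial, mul_one] at h
    rw [inner_fderiv_tangentProj_left hU hf hinj hx (pullback f x (e i)),
      real_inner_comm (e i : V) (fderiv ℝ f x ζ)] at h
    linarith
  -- Half the derivative of |τ|² = mλ.
  have hlamζ : ⟪fderiv ℝ τ x ζ, τ x⟫_ℝ = (m : ℝ) / 2 * fderiv ℝ lam x ζ := by
    have dτ := differentiableAt_of_contDiffOn hU hτ hx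
    have h := congrArg (fun L => L ζ) (fderiv_eq_of_eqOn (g := fun y => (m : ℝ) * lam y)
      (h := fun y => ⟪τ y, τ y⟫_ℝ) hU hx fun y hy => by
        rw [hlam' y hy, real_inner_self_eq_norm_sq]; field_simp)
    beta_reduce at h
    rw [fderiv_inner_apply ℝ dτ dτ, fderiv_const_mul (differentiableAt_of_contDiffOn hU hlam hx),
      real_inner_comm] at h
    simp at h
    linarith
  have hmean' : ∑ i, ⟪fderiv ℝ τ x ζ, fderiv ℝ (tangentProj f) x (pullback f x (e i)) (e i)⟫_ℝ
      = (m : ℝ) / 2 * fderiv ℝ lam x ζ := by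
    rw [← inner_sum, hmean, inner_sub_right, inner_smul_right, hperp, hlamζ]; ring
  -- The coefficient of dλ(ζ) is -1 - (m/2 + 1 - m) = m/2 - 2.
  simp_rw [fun i => inner_fderiv_fderiv_pullback hU hf hinj hx hτ hlam hnormal hshape (e i) (hP i) ζ,
    hcod, Finset.sum_sub_distrib, Finset.sum_add_distrib, Finset.sum_neg_distrib, hsum, hmean']
  simp [hι]
  ring

end

end ImmersionChart
end

/-! ### Connection and curvature of the unit sphere. -/

section
open scoped InnerProductSpace Topology

namespace SphereSubmanifold

variable {n : ℕ}

lemma sphereProj_apply (y v : Ambient n) : sphereProj y v = v - (⟪y, v⟫_ℝ / ‖y‖ ^ 2) • y := by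
  rw [sphereProj, Submodule.starProjection_orthogonal_val, Submodule.starProjection_singleton]
  simp

lemma sphereProj_eq_self {y v : Ambient n} (h : ⟪y, v⟫_ℝ = 0) : sphereProj y v = v := by
  simp [sphereProj_apply, h]

lemma inner_sphereProj (y v : Ambient n) : ⟪y, sphereProj y v⟫_ℝ = 0 := by
  by_cases hy : y = 0
  · simp [hy]
  · have : ‖y‖ ≠ 0 := by simpa using hy
    rw [sphereProj_apply, inner_sub_right, inner_smul_right, real_inner_self_eq_norm_sq]
    field_simp
    ring

/-- In directions orthogonal to y the norm is stationary, so only the numerator is differentiated.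
-/
lemma exists_hasFDerivAt_inner_div {y : Ambient n} (hy : y ≠ 0) (c : Ambient n) :
    ∃ L : Ambient n →L[ℝ] ℝ, HasFDerivAt (fun z => ⟪z, c⟫_ℝ / ‖z‖ ^ 2) L y ∧
      ∀ u, ⟪y, u⟫_ℝ = 0 → L u = ⟪u, c⟫_ℝ / ‖y‖ ^ 2 := by
  have hy' : ‖y‖ ^ 2 ≠ 0 := by simpa using hy
  have h2 := (hasFDerivAt_id y).inner ℝ (hasFDerivAt_const c y)
  have h3 : HasFDerivAt (fun z : Ambient n => (‖z‖ ^ 2)⁻¹) _ y :=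
    (hasDerivAt_inv hy').comp_hasFDerivAt y (hasStrictFDerivAt_norm_sq y).hasFDerivAt
  simp_rw [div_eq_mul_inv]
  refine ⟨_, h2.mul h3, fun u hu => ?_⟩
  simp [hu, mul_comm]

lemma hasFDerivAt_sphereProj {y : Ambient n} (hy : y ≠ 0) (c : Ambient n) :
    DifferentiableAt ℝ (fun z => sphereProj z c) y ∧ ∀ u, ⟪y, u⟫_ℝ = 0 →
      fderiv ℝ (fun z => sphereProj z c) y u
        = -((⟪u, c⟫_ℝ / ‖y‖ ^ 2) • y) - (⟪y, c⟫_ℝ / ‖y‖ ^ 2) • u := by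
  obtain ⟨L, hL, hL'⟩ := exists_hasFDerivAt_inner_div hy c
  have h4 := (hL.smul (hasFDerivAt_id y)).const_sub c
  have heq : (fun z => sphereProj z c) = fun z => c - (⟪z, c⟫_ℝ / ‖z‖ ^ 2) • z :=
    funext fun z => sphereProj_apply z c
  rw [heq]
  refine ⟨h4.differentiableAt, fun u hu => ?_⟩
  rw [show fderiv ℝ (fun z => c - (⟪z, c⟫_ℝ / ‖z‖ ^ 2) • z) y = _ from h4.fderiv]
  simp [hL' u hu]
  abel

lemma sphereNabla_sphereProj {y : Ambient n} (hy : y ≠ 0) (c : Ambient n) {u : Ambient n}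
    (hu : ⟪y, u⟫_ℝ = 0) :
    sphereNabla (fun z => sphereProj z c) y u = -((⟪y, c⟫_ℝ / ‖y‖ ^ 2) • u) := by
  have h0 : sphereProj y y = 0 := by
    have : ‖y‖ ≠ 0 := by simpa using hy
    rw [sphereProj_apply, real_inner_self_eq_norm_sq, div_self (by positivity), one_smul, sub_self]
  rw [sphereNabla, (hasFDerivAt_sphereProj hy c).2 u hu, map_sub, map_neg, map_smul, map_smul, h0,
    sphereProj_eq_self hu]
  simp

/-- The sphere has constant curvature `1`. -/
lemma sphereCurvature_eq {y a b c : Ambient n} (hy : ‖y‖ = 1) (ha : ⟪y, a⟫_ℝ = 0)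
    (hb : ⟪y, b⟫_ℝ = 0) (hc : ⟪y, c⟫_ℝ = 0) :
    sphereCurvature y a b c = ⟪b, c⟫_ℝ • a - ⟪a, c⟫_ℝ • b := by
  have hy0 : y ≠ 0 := by rintro rfl; simp at hy
  -- The inner derivative is explicit near y, and its coefficient vanishes at y because c ⟂ y; only
  -- the derivative of the coefficient survives.
  have key (b a : Ambient n) (hb : ⟪y, b⟫_ℝ = 0) (ha : ⟪y, a⟫_ℝ = 0) :
      sphereNabla (fun z => sphereNabla (fun x => sphereProj x c) z (sphereProj z b)) y a
        = -(⟪a, c⟫_ℝ • b) := by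
    have hev : (fun z => sphereNabla (fun x => sphereProj x c) z (sphereProj z b)) =ᶠ[𝓝 y]
        fun z => -((⟪z, c⟫_ℝ / ‖z‖ ^ 2) • sphereProj z b) := by
      filter_upwards [isOpen_ne.mem_nhds hy0] with z hz
      exact sphereNabla_sphereProj hz c (inner_sphereProj z b)
    obtain ⟨L, hL, hL'⟩ := exists_hasFDerivAt_inner_div hy0 c
    have h4 := (hL.smul (hasFDerivAt_sphereProj hy0 b).1.hasFDerivAt).neg
    rw [sphereNabla, hev.fderiv_eq,
      show fderiv ℝ (fun z => -((⟪z, c⟫_ℝ / ‖z‖ ^ 2) • sphereProj z b)) y = _ from h4.fderiv]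
    simp [hc, hL' a ha, hy, sphereProj_eq_self hb]
  -- At y the derivative of each extended field along the other vector is -⟪a, b⟫ y, symmetric in a
  -- and b.
  have hbr : VectorField.lieBracket ℝ (fun z => sphereProj z a) (fun z => sphereProj z b) y = 0 := by
    rw [VectorField.lieBracket, sphereProj_eq_self ha, sphereProj_eq_self hb,
      (hasFDerivAt_sphereProj hy0 b).2 a ha, (hasFDerivAt_sphereProj hy0 a).2 b hb, ha, hb,
      real_inner_comm]
    simp
  rw [sphereCurvature, key b a hb ha, key a b ha hb, hbr, sphereNabla]
  simp
  abel

end SphereSubmanifold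
end

/-! ### Invariant objects on M expressed in a chart. -/

section
open scoped InnerProductSpace Topology
open ImmersionChart

namespace SphereSubmanifold

variable {m n : ℕ} {M : Type*} [TopologicalSpace M] [ChartedSpace (EuclideanSpace ℝ (Fin m)) M]

variable (m) in
/-- The inverse of the chart at `p₀`. -/
noncomputable def param (p₀ : M) : EuclideanSpace ℝ (Fin m) → M := (extChartAt (𝓡 m) p₀).symm

variable (m) in
/-- The domain of `param m p₀`. -/
noncomputable def paramDomain (p₀ : M) : Set (EuclideanSpace ℝ (Fin m)) := (extChartAt (𝓡 m) p₀).target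

variable (m) in
/-- A map `φ` into the sphere, written in the chart at `p₀`. -/
noncomputable def chartMap (φ : M → UnitSphere n) (p₀ : M) (x : EuclideanSpace ℝ (Fin m)) : Ambient n := φ (param m p₀ x)

variable (m) in
lemma isOpen_paramDomain (p₀ : M) : IsOpen (paramDomain m p₀) := isOpen_extChartAt_target p₀

variable (m) in
lemma norm_chartMap (φ : M → UnitSphere n) (p₀ : M) (x : EuclideanSpace ℝ (Fin m)) : ‖chartMap m φ p₀ x‖ = 1 := by
  simp [chartMap]

variable [IsManifold (𝓡 m) ∞ M] {p₀ : M} {x : EuclideanSpace ℝ (Fin m)}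

variable (m) in
/-- The differential of `param m p₀`. -/
noncomputable def paramDeriv (p₀ : M) (x : EuclideanSpace ℝ (Fin m)) : EuclideanSpace ℝ (Fin m) →L[ℝ] TangentSpace (𝓡 m) (param m p₀ x) :=
  mfderiv 𝓘(ℝ, EuclideanSpace ℝ (Fin m)) (𝓡 m) (param m p₀) x

lemma mdifferentiableAt_param (hx : x ∈ paramDomain m p₀) :
    MDifferentiableAt 𝓘(ℝ, EuclideanSpace ℝ (Fin m)) (𝓡 m) (param m p₀) x :=
  (((contMDiffOn_extChartAt_symm (I := 𝓡 m) (n := ∞) p₀) x hx).contMDiffAt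
    ((isOpen_paramDomain m p₀).mem_nhds hx)).mdifferentiableAt (by simp)

lemma bijective_paramDeriv (hx : x ∈ paramDomain m p₀) : Function.Bijective (paramDeriv m p₀ x) := by
  have : IsManifold (𝓡 m) 1 M := .of_le (n := ∞) (by simp)
  obtain ⟨e, he⟩ := isInvertible_mfderivWithin_extChartAt_symm (I := 𝓡 m) hx
  rw [ModelWithCorners.range_eq_univ, mfderivWithin_univ] at he
  unfold paramDeriv param
  rw [← he]
  exact e.bijective

omit [IsManifold (𝓡 m) ∞ M] in
lemma eventuallyEq_comp_param {F : Type*} (X : M → F) (hx : x ∈ paramDomain m p₀) :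
    X =ᶠ[𝓝 (param m p₀ x)] (fun y => X (param m p₀ y)) ∘ extChartAt (𝓡 m) p₀ := by
  filter_upwards [extChartAt_source_mem_nhds' (I := 𝓡 m) ((extChartAt (𝓡 m) p₀).map_target hx)]
    with q hq
  exact congrArg X ((extChartAt (𝓡 m) p₀).left_inv hq).symm

lemma mvfderiv_paramDeriv {X : M → Ambient n} (hx : x ∈ paramDomain m p₀)
    (hX : DifferentiableAt ℝ (fun y => X (param m p₀ y)) x) (ξ : EuclideanSpace ℝ (Fin m)) :
    mvfderiv (𝓡 m) X (param m p₀ x) (paramDeriv m p₀ x ξ) = fderiv ℝ (fun y => X (param m p₀ y)) x ξ := by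
  have : IsManifold (𝓡 m) 1 M := .of_le (n := ∞) (by simp)
  have hq : param m p₀ x ∈ (extChartAt (𝓡 m) p₀).source := (extChartAt (𝓡 m) p₀).map_target hx
  have hxq : extChartAt (𝓡 m) p₀ (param m p₀ x) = x := (extChartAt (𝓡 m) p₀).right_inv hx
  have hX' : MDifferentiableAt (𝓡 m) 𝓘(ℝ, Ambient n) X (param m p₀ x) := by
    refine MDifferentiableAt.congr_of_eventuallyEq ?_ (eventuallyEq_comp_param X hx)
    refine MDifferentiableAt.comp _ ?_ (mdifferentiableAt_extChartAt (by simpa using hq))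
    rw [hxq]
    exact hX.mdifferentiableAt
  have h := mfderiv_comp_apply x hX' (mdifferentiableAt_param hx) ξ
  rw [show X ∘ param m p₀ = fun y => X (param m p₀ y) from rfl, mfderiv_eq_fderiv] at h
  exact h.symm

variable {φ : M → UnitSphere n}

lemma contMDiff_unitSphere_coe (n : ℕ) :
    ContMDiff (𝓡 n) 𝓘(ℝ, Ambient n) ∞ ((↑) : UnitSphere n → Ambient n) :=
  have := Fact.mk (finrank_euclideanSpace_fin (𝕜 := ℝ) (n := n + 1))
  contMDiff_coe_sphere

lemma injective_mfderiv_unitSphere_coe (v : UnitSphere n) : Function.Injective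
    (mfderiv (𝓡 n) 𝓘(ℝ, Ambient n) ((↑) : UnitSphere n → Ambient n) v) :=
  have := Fact.mk (finrank_euclideanSpace_fin (𝕜 := ℝ) (n := n + 1))
  injective_mvfderiv_subtypeVal_sphere v

lemma contDiffOn_chartMap (hφ : ContMDiff (𝓡 m) (𝓡 n) ∞ φ) :
    ContDiffOn ℝ ∞ (chartMap m φ p₀) (paramDomain m p₀) := by
  rw [← contMDiffOn_iff_contDiffOn]
  exact ((contMDiff_unitSphere_coe n).comp hφ).comp_contMDiffOn (contMDiffOn_extChartAt_symm p₀)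

omit [IsManifold (𝓡 m) ∞ M] in
lemma injective_differential (hφ : ContMDiff (𝓡 m) (𝓡 n) ∞ φ)
    (himm : ∀ p : M, Function.Injective (mfderiv (𝓡 m) (𝓡 n) φ p)) (p : M) :
    Function.Injective (differential m φ p) := by
  have h1 : MDifferentiableAt (𝓡 n) 𝓘(ℝ, Ambient n) ((↑) : UnitSphere n → Ambient n) (φ p) :=
    (contMDiff_unitSphere_coe n (φ p)).mdifferentiableAt (by simp)
  have h2 : MDifferentiableAt (𝓡 m) (𝓡 n) φ p := (hφ p).mdifferentiableAt (by simp)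
  intro v w hvw
  apply himm p
  apply injective_mfderiv_unitSphere_coe (φ p)
  have h (v : TangentSpace (𝓡 m) p) := mfderiv_comp_apply p h1 h2 v
  exact (h v).symm.trans (hvw.trans (h w))

lemma differential_paramDeriv (hφ : ContMDiff (𝓡 m) (𝓡 n) ∞ φ) (hx : x ∈ paramDomain m p₀) (ξ : EuclideanSpace ℝ (Fin m)) :
    differential m φ (param m p₀ x) (paramDeriv m p₀ x ξ) = fderiv ℝ (chartMap m φ p₀) x ξ :=
  mvfderiv_paramDeriv (X := fun q => (φ q : Ambient n)) hx
    (differentiableAt_of_contDiffOn (isOpen_paramDomain m p₀) (contDiffOn_chartMap hφ) hx) ξ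

lemma tangentSpaceIn_param (hφ : ContMDiff (𝓡 m) (𝓡 n) ∞ φ) (hx : x ∈ paramDomain m p₀) :
    tangentSpaceIn m φ (param m p₀ x) = (fderiv ℝ (chartMap m φ p₀) x).range := by
  ext v
  constructor
  · rintro ⟨w, rfl⟩
    obtain ⟨ξ, rfl⟩ := (bijective_paramDeriv hx).2 w
    exact ⟨ξ, (differential_paramDeriv hφ hx ξ).symm⟩
  · rintro ⟨ξ, rfl⟩
    exact ⟨paramDeriv m p₀ x ξ, differential_paramDeriv hφ hx ξ⟩

/-- Carries the basis used in `traceAt` over to the range of the chart differential, indexed by `Fin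
m`. -/
lemma exists_orthonormalBasis_sum_eq {S T : Submodule ℝ (Ambient n)} (h : S = T)
    (hrank : Module.finrank ℝ T = m) : ∃ e : OrthonormalBasis (Fin m) ℝ T,
      ∀ β : Ambient n → Ambient n → Ambient n, ∑ i, β (stdOrthonormalBasis ℝ S i : Ambient n)
        (stdOrthonormalBasis ℝ S i : Ambient n) = ∑ i, β (e i : Ambient n) (e i : Ambient n) := by
  subst h
  refine ⟨(stdOrthonormalBasis ℝ S).reindex (finCongr hrank), fun β => ?_⟩
  simp only [OrthonormalBasis.reindex_apply]
  exact (Equiv.sum_comp (finCongr hrank).symm fun i => β (stdOrthonormalBasis ℝ S i)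
    (stdOrthonormalBasis ℝ S i)).symm

variable (m) in
/-- `φ` is a smooth immersion. -/
structure IsSmoothImmersion (φ : M → UnitSphere n) : Prop where
  contMDiff : ContMDiff (𝓡 m) (𝓡 n) ∞ φ
  injective : ∀ p : M, Function.Injective (mfderiv (𝓡 m) (𝓡 n) φ p)

variable (hφ : IsSmoothImmersion m φ)
include hφ

lemma IsSmoothImmersion.contDiffOn : ContDiffOn ℝ ∞ (chartMap m φ p₀) (paramDomain m p₀) :=
  contDiffOn_chartMap hφ.contMDiff

lemma IsSmoothImmersion.injective_fderiv :
    ∀ x ∈ (paramDomain m p₀), Function.Injective (fderiv ℝ (chartMap m φ p₀) x) := by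
  intro x hx
  have : ⇑(fderiv ℝ (chartMap m φ p₀) x) = differential m φ (param m p₀ x) ∘ paramDeriv m p₀ x :=
    funext fun ξ => (differential_paramDeriv hφ.contMDiff hx ξ).symm
  rw [this]
  exact (injective_differential hφ.contMDiff hφ.injective _).comp (bijective_paramDeriv hx).1

lemma nabla_param {X : M → Ambient n} (hx : x ∈ paramDomain m p₀)
    (hX : DifferentiableAt ℝ (fun y => X (param m p₀ y)) x) {v : Ambient n}
    (hv : v ∈ tangentSpaceIn m φ (param m p₀ x)) :
    nabla m φ X (param m p₀ x) v = sphereProj (chartMap m φ p₀ x)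
      (fderiv ℝ (fun y => X (param m p₀ y)) x (pullback (chartMap m φ p₀) x v)) := by
  rw [tangentSpaceIn_param hφ.contMDiff hx] at hv
  obtain ⟨ξ, rfl⟩ := hv
  have h1 : pullback (chartMap m φ p₀) x (fderiv ℝ (chartMap m φ p₀) x ξ) = ξ :=
    leftInv_apply (hφ.injective_fderiv x hx) ξ
  have h2 : tangentVector m φ (param m p₀ x) (fderiv ℝ (chartMap m φ p₀) x ξ) = paramDeriv m p₀ x ξ := by
    rw [tangentVector, ← differential_paramDeriv hφ.contMDiff hx]
    exact Function.leftInverse_invFun (injective_differential hφ.contMDiff hφ.injective _) _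
  simp only [ContinuousLinearMap.coe_coe]
  rw [nabla, h1, h2, mvfderiv_paramDeriv hx hX]
  rfl

lemma extend_param (hx : x ∈ paramDomain m p₀) (w : Ambient n) :
    extend m φ w (param m p₀ x) = tangentProj (chartMap m φ p₀) x w := by
  rw [extend, tangentProj]
  simp only [tangentSpaceIn_param hφ.contMDiff hx]

lemma inner_chartMap_fderiv (hx : x ∈ paramDomain m p₀) (ξ : EuclideanSpace ℝ (Fin m)) :
    ⟪chartMap m φ p₀ x, fderiv ℝ (chartMap m φ p₀) x ξ⟫_ℝ = 0 := by
  have df := differentiableAt_of_contDiffOn (isOpen_paramDomain m p₀) hφ.contDiffOn hx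
  have h := congrArg (fun L => L ξ) (fderiv_eq_of_eqOn
    (g := fun y => ⟪chartMap m φ p₀ y, chartMap m φ p₀ y⟫_ℝ) (h := fun y => 1) (isOpen_paramDomain m p₀) hx
    fun y _ => by rw [real_inner_self_eq_norm_sq, norm_chartMap, one_pow])
  beta_reduce at h
  rw [fderiv_inner_apply ℝ df df, real_inner_comm] at h
  simp at h
  rwa [real_inner_comm] at h

lemma tangentProj_chartMap (hx : x ∈ paramDomain m p₀) :
    tangentProj (chartMap m φ p₀) x (chartMap m φ p₀ x) = 0 := by
  refine Submodule.eq_starProjection_of_mem_of_inner_eq_zero (zero_mem _) ?_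
  rintro _ ⟨ξ, rfl⟩
  simpa using inner_chartMap_fderiv hφ hx ξ

lemma tangentProj_sphereProj (hx : x ∈ paramDomain m p₀) (v : Ambient n) :
    tangentProj (chartMap m φ p₀) x (sphereProj (chartMap m φ p₀ x) v) = tangentProj (chartMap m φ p₀) x v := by
  rw [sphereProj_apply, map_sub, map_smul, tangentProj_chartMap hφ hx, smul_zero, sub_zero]

lemma nabla_extend_param (hx : x ∈ paramDomain m p₀) {v : Ambient n}
    (hv : v ∈ tangentSpaceIn m φ (param m p₀ x)) (w : Ambient n) :
    nabla m φ (extend m φ w) (param m p₀ x) v = sphereProj (chartMap m φ p₀ x)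
      (fderiv ℝ (tangentProj (chartMap m φ p₀)) x (pullback (chartMap m φ p₀) x v) w) := by
  have hU := isOpen_paramDomain m p₀
  have dP := differentiableAt_of_contDiffOn hU
    (contDiffOn_tangentProj hU hφ.contDiffOn hφ.injective_fderiv) hx
  have hev : (fun y => extend m φ w (param m p₀ y)) =ᶠ[𝓝 x] fun y => tangentProj (chartMap m φ p₀) y w :=
    Filter.mem_of_superset (hU.mem_nhds hx) fun y hy => extend_param hφ hy w
  have dPw : DifferentiableAt ℝ (fun y => tangentProj (chartMap m φ p₀) y w) x := by fun_prop
  rw [nabla_param hφ hx (hev.differentiableAt_iff.2 dPw) hv, hev.fderiv_eq,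
    fderiv_clm_apply dP (by fun_prop)]
  simp

lemma tangentProj_nabla_extend (hx : x ∈ paramDomain m p₀) {v w : Ambient n}
    (hv : v ∈ tangentSpaceIn m φ (param m p₀ x)) (hw : w ∈ tangentSpaceIn m φ (param m p₀ x)) :
    tangentProj (chartMap m φ p₀) x (nabla m φ (extend m φ w) (param m p₀ x) v) = 0 := by
  rw [nabla_extend_param hφ hx hv, tangentProj_sphereProj hφ hx]
  rw [tangentSpaceIn_param hφ.contMDiff hx] at hw
  obtain ⟨η, rfl⟩ := hw
  exact tangentProj_fderiv_tangentProj (isOpen_paramDomain m p₀) hφ.contDiffOn hφ.injective_fderiv hx _ _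

/-- Since P DP P = 0, extensions by projection are parallel at the point for the induced connection,
and the correction terms of second covariant derivatives drop out. -/
lemma tangentNabla_extend (hx : x ∈ paramDomain m p₀) {v w : Ambient n}
    (hv : v ∈ tangentSpaceIn m φ (param m p₀ x)) (hw : w ∈ tangentSpaceIn m φ (param m p₀ x)) :
    tangentNabla m φ (extend m φ w) (param m p₀ x) v = 0 := by
  have h := tangentProj_nabla_extend hφ hx hv hw
  rw [tangentNabla]
  simpa only [tangentProj, tangentSpaceIn_param hφ.contMDiff hx] using h

lemma nablaDifferential_param (hx : x ∈ paramDomain m p₀) {v w : Ambient n}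
    (hv : v ∈ tangentSpaceIn m φ (param m p₀ x)) (hw : w ∈ tangentSpaceIn m φ (param m p₀ x)) :
    nablaDifferential m φ (param m p₀ x) v w = nabla m φ (extend m φ w) (param m p₀ x) v := by
  rw [nablaDifferential, tangentNabla_extend hφ hx hv hw, sub_zero]

lemma secondFundamentalForm_param (hx : x ∈ paramDomain m p₀) {v w : Ambient n}
    (hv : v ∈ tangentSpaceIn m φ (param m p₀ x)) (hw : w ∈ tangentSpaceIn m φ (param m p₀ x)) :
    secondFundamentalForm m φ (param m p₀ x) v w = nabla m φ (extend m φ w) (param m p₀ x) v := by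
  rw [secondFundamentalForm, Submodule.starProjection_eq_self_iff]
  refine ⟨?_, ?_⟩
  · rw [SetLike.mem_coe, ← Submodule.starProjection_apply_eq_zero_iff]
    exact tangentNabla_extend hφ hx hv hw
  · exact Submodule.starProjection_apply_mem _ _

lemma exists_basis_traceAt (hx : x ∈ paramDomain m p₀) :
    ∃ e : OrthonormalBasis (Fin m) ℝ (fderiv ℝ (chartMap m φ p₀) x).range,
      ∀ β, traceAt m φ (param m p₀ x) β = ∑ i, β (e i : Ambient n) (e i : Ambient n) := by
  have hrank : Module.finrank ℝ (fderiv ℝ (chartMap m φ p₀) x).range = m := by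
    rw [LinearMap.finrank_range_of_inj (hφ.injective_fderiv x hx)]
    simp
  exact exists_orthonormalBasis_sum_eq (tangentSpaceIn_param hφ.contMDiff hx) hrank

end SphereSubmanifold
end

/-! ### The mean curvature vector in a chart and the tangential biharmonic equation. -/

section
open scoped InnerProductSpace Topology
open ImmersionChart

namespace SphereSubmanifold

variable {m n : ℕ} {M : Type*} [TopologicalSpace M] [ChartedSpace (EuclideanSpace ℝ (Fin m)) M]
  [IsManifold (𝓡 m) ∞ M] {p₀ : M} {x : EuclideanSpace ℝ (Fin m)} {φ : M → UnitSphere n}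

/-- The vector `m H` in a chart: `tr ∇P + m f`, where `P` is the orthogonal projection onto the
tangent spaces of the immersion `f` into the sphere. -/
noncomputable def tensionField (f : EuclideanSpace ℝ (Fin m) → Ambient n)
    (x : EuclideanSpace ℝ (Fin m)) : Ambient n :=
  ∑ j, fderiv ℝ (tangentProj f) x (pullback f x (EuclideanSpace.basisFun (Fin (n + 1)) ℝ j))
    (EuclideanSpace.basisFun (Fin (n + 1)) ℝ j) + (m : ℝ) • f x

lemma pullback_tangentProj {f : EuclideanSpace ℝ (Fin m) → Ambient n}
    (hinj : Function.Injective (fderiv ℝ f x)) (v : Ambient n) :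
    pullback f x (tangentProj f x v) = pullback f x v :=
  (congrArg (pullback f x) (apply_leftInv hinj v)).symm.trans (leftInv_apply hinj _)

/-- The pointwise chosen tangent bases need not vary smoothly. Passing to a fixed ambient basis is
what makes the trace visibly smooth in x. -/
lemma sum_fderiv_tangentProj {f : EuclideanSpace ℝ (Fin m) → Ambient n}
    (hinj : Function.Injective (fderiv ℝ f x)) {ι : Type*} [Fintype ι]
    (e : OrthonormalBasis ι ℝ (fderiv ℝ f x).range) :
    ∑ i, fderiv ℝ (tangentProj f) x (pullback f x (e i)) (e i)
      = tensionField f x - (m : ℝ) • f x := by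
  have h := sum_orthonormalBasis_submodule e (EuclideanSpace.basisFun (Fin (n + 1)) ℝ)
    ((ContinuousLinearMap.coeLM ℝ).comp
      ((fderiv ℝ (tangentProj f) x ∘L pullback f x : Ambient n →L[ℝ] Ambient n →L[ℝ] Ambient n) :
        Ambient n →ₗ[ℝ] Ambient n →L[ℝ] Ambient n))
  rw [tensionField, add_sub_cancel_right]
  refine Eq.trans h (Finset.sum_congr rfl fun j _ => ?_)
  exact congrArg (fun ξ => fderiv ℝ (tangentProj f) x ξ (EuclideanSpace.basisFun (Fin (n + 1)) ℝ j))
    (pullback_tangentProj hinj _)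

variable (hφ : IsSmoothImmersion m φ)
include hφ

lemma contDiffOn_tensionField : ContDiffOn ℝ ∞ (tensionField (chartMap m φ p₀)) (paramDomain m p₀) := by
  have hU := isOpen_paramDomain m p₀
  have ca := contDiffOn_pullback hU hφ.contDiffOn hφ.injective_fderiv
  have cP' := contDiffOn_fderiv hU (contDiffOn_tangentProj hU hφ.contDiffOn hφ.injective_fderiv)
  refine ContDiffOn.add (ContDiffOn.sum fun j _ => ?_) (hφ.contDiffOn.const_smul _)
  exact (cP'.clm_apply (ca.clm_apply contDiffOn_const)).clm_apply contDiffOn_const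

lemma fderiv_tangentProj_chartMap (hx : x ∈ paramDomain m p₀) (ξ : EuclideanSpace ℝ (Fin m)) :
    fderiv ℝ (tangentProj (chartMap m φ p₀)) x ξ (chartMap m φ p₀ x)
      = -fderiv ℝ (chartMap m φ p₀) x ξ := by
  have hU := isOpen_paramDomain m p₀
  have dP := differentiableAt_of_contDiffOn hU
    (contDiffOn_tangentProj hU hφ.contDiffOn hφ.injective_fderiv) hx
  have df := differentiableAt_of_contDiffOn hU hφ.contDiffOn hx
  have h := congrArg (fun L => L ξ) (fderiv_eq_of_eqOn
    (g := fun y => tangentProj (chartMap m φ p₀) y (chartMap m φ p₀ y)) (h := fun y => 0) hU hx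
    fun y hy => tangentProj_chartMap hφ hy)
  beta_reduce at h
  rw [fderiv_clm_apply dP df] at h
  simp [tangentProj_fderiv] at h
  exact eq_neg_of_add_eq_zero_right h

/-- By self-adjointness and DP(ξ)f = -Df ξ, each `e i` contributes radial component -1; removing
them adds m f. -/
lemma sphereProj_sum_fderiv_tangentProj (hx : x ∈ paramDomain m p₀)
    (e : OrthonormalBasis (Fin m) ℝ (fderiv ℝ (chartMap m φ p₀) x).range) :
    sphereProj (chartMap m φ p₀ x) (∑ i, fderiv ℝ (tangentProj (chartMap m φ p₀)) x
      (pullback (chartMap m φ p₀) x (e i)) (e i)) = tensionField (chartMap m φ p₀) x := by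
  have h (i : Fin m) : ⟪chartMap m φ p₀ x, fderiv ℝ (tangentProj (chartMap m φ p₀)) x
      (pullback (chartMap m φ p₀) x (e i)) (e i)⟫_ℝ = -1 := by
    have hJa : fderiv ℝ (chartMap m φ p₀) x (pullback (chartMap m φ p₀) x (e i)) = e i :=
      (apply_leftInv (hφ.injective_fderiv x hx) _).trans
        (Submodule.starProjection_eq_self_iff.2 (e i).2)
    rw [← inner_fderiv_tangentProj_left (isOpen_paramDomain m p₀) hφ.contDiffOn hφ.injective_fderiv hx,
      fderiv_tangentProj_chartMap hφ hx, hJa, inner_neg_left, ← Submodule.coe_inner,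
      real_inner_self_eq_norm_sq, e.orthonormal.1 i]
    norm_num
  rw [sphereProj_apply, inner_sum, norm_chartMap, Finset.sum_congr rfl fun i _ => h i,
    sum_fderiv_tangentProj (hφ.injective_fderiv x hx)]
  simp

lemma traceAt_nabla_extend (hx : x ∈ paramDomain m p₀) :
    traceAt m φ (param m p₀ x) (fun v w => nabla m φ (extend m φ w) (param m p₀ x) v)
      = tensionField (chartMap m φ p₀) x := by
  obtain ⟨e, he⟩ := exists_basis_traceAt hφ hx
  rw [he, ← sphereProj_sum_fderiv_tangentProj hφ hx e, map_sum]
  refine Finset.sum_congr rfl fun i _ => nabla_extend_param hφ hx ?_ _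
  rw [tangentSpaceIn_param hφ.contMDiff hx]
  exact (e i).2

omit [IsManifold (𝓡 m) ∞ M] hφ in
lemma traceAt_congr {p : M} {β γ : Ambient n → Ambient n → Ambient n}
    (h : ∀ v ∈ tangentSpaceIn m φ p, β v v = γ v v) : traceAt m φ p β = traceAt m φ p γ :=
  Finset.sum_congr rfl fun i _ => h _ (stdOrthonormalBasis ℝ (tangentSpaceIn m φ p) i).2

lemma divDifferential_param (hx : x ∈ paramDomain m p₀) :
    divDifferential m φ (param m p₀ x) = -tensionField (chartMap m φ p₀) x := by
  rw [divDifferential, ← traceAt_nabla_extend hφ hx,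
    traceAt_congr (γ := fun v w => nabla m φ (extend m φ w) (param m p₀ x) v)
      fun v hv => nablaDifferential_param hφ hx hv hv]

lemma meanCurvature_param (hx : x ∈ paramDomain m p₀) :
    meanCurvature m φ (param m p₀ x) = (m : ℝ)⁻¹ • tensionField (chartMap m φ p₀) x := by
  rw [meanCurvature, ← traceAt_nabla_extend hφ hx,
    traceAt_congr (γ := fun v w => nabla m φ (extend m φ w) (param m p₀ x) v)
      fun v hv => secondFundamentalForm_param hφ hx hv hv]

lemma inner_tensionField_chartMap (hx : x ∈ paramDomain m p₀) :
    ⟪tensionField (chartMap m φ p₀) x, chartMap m φ p₀ x⟫_ℝ = 0 := by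
  obtain ⟨e, -⟩ := exists_basis_traceAt hφ hx
  rw [← sphereProj_sum_fderiv_tangentProj hφ hx e, real_inner_comm, inner_sphereProj]

lemma tangentProj_tensionField (hx : x ∈ paramDomain m p₀) :
    tangentProj (chartMap m φ p₀) x (tensionField (chartMap m φ p₀) x) = 0 := by
  obtain ⟨e, -⟩ := exists_basis_traceAt hφ hx
  rw [← sphereProj_sum_fderiv_tangentProj hφ hx e, tangentProj_sphereProj hφ hx, map_sum]
  refine Finset.sum_eq_zero fun i _ => ?_
  obtain ⟨ξ, hξ⟩ := (e i).2
  rw [← hξ]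
  exact tangentProj_fderiv_tangentProj (isOpen_paramDomain m p₀) hφ.contDiffOn hφ.injective_fderiv hx _ _

lemma inner_tensionField_fderiv (hx : x ∈ paramDomain m p₀) (ξ : EuclideanSpace ℝ (Fin m)) :
    ⟪tensionField (chartMap m φ p₀) x, fderiv ℝ (chartMap m φ p₀) x ξ⟫_ℝ = 0 := by
  rw [← tangentProj_fderiv, ← inner_tangentProj_left, tangentProj_tensionField hφ hx, inner_zero_left]

lemma inner_fderiv_tensionField_chartMap (hx : x ∈ paramDomain m p₀) (ξ : EuclideanSpace ℝ (Fin m)) :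
    ⟪fderiv ℝ (tensionField (chartMap m φ p₀)) x ξ, chartMap m φ p₀ x⟫_ℝ = 0 := by
  have hU := isOpen_paramDomain m p₀
  have df := differentiableAt_of_contDiffOn hU hφ.contDiffOn hx
  have dτ := differentiableAt_of_contDiffOn hU (contDiffOn_tensionField hφ) hx
  have h := congrArg (fun L => L ξ) (fderiv_eq_of_eqOn
    (g := fun y => ⟪tensionField (chartMap m φ p₀) y, chartMap m φ p₀ y⟫_ℝ) (h := fun y => 0) hU hx
    fun y hy => inner_tensionField_chartMap hφ hy)
  beta_reduce at h
  rw [fderiv_inner_apply ℝ dτ df, inner_tensionField_fderiv hφ hx] at h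
  simpa using h

/-- The covariant derivative of `δTφ` is its derivative in the ambient space, because that derivative
is orthogonal to the position vector. -/
lemma nabla_divDifferential_param (hx : x ∈ paramDomain m p₀) {v : Ambient n}
    (hv : v ∈ tangentSpaceIn m φ (param m p₀ x)) :
    nabla m φ (divDifferential m φ) (param m p₀ x) v
      = -fderiv ℝ (tensionField (chartMap m φ p₀)) x (pullback (chartMap m φ p₀) x v) := by
  have hU := isOpen_paramDomain m p₀
  have dτ := differentiableAt_of_contDiffOn hU (contDiffOn_tensionField hφ) hx
  have hev : (fun y => divDifferential m φ (param m p₀ y)) =ᶠ[𝓝 x]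
      fun y => -tensionField (chartMap m φ p₀) y :=
    Filter.mem_of_superset (hU.mem_nhds hx) fun y hy => divDifferential_param hφ hy
  rw [nabla_param hφ hx (hev.differentiableAt_iff.2 dτ.neg) hv, hev.fderiv_eq, fderiv_fun_neg,
    neg_apply, map_neg, sphereProj_eq_self]
  rw [real_inner_comm, inner_fderiv_tensionField_chartMap hφ hx]

lemma secondNabla_divDifferential_param (hx : x ∈ paramDomain m p₀) {v : Ambient n}
    (hv : v ∈ tangentSpaceIn m φ (param m p₀ x)) :
    secondNabla m φ (divDifferential m φ) (param m p₀ x) v v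
      = -sphereProj (chartMap m φ p₀ x) (fderiv ℝ (fun y => fderiv ℝ
        (tensionField (chartMap m φ p₀)) y (pullback (chartMap m φ p₀) y v)) x
          (pullback (chartMap m φ p₀) x v)) := by
  have hU := isOpen_paramDomain m p₀
  have dτ' := differentiableAt_of_contDiffOn hU (contDiffOn_fderiv hU (contDiffOn_tensionField hφ)) hx
  have da := differentiableAt_of_contDiffOn hU
    (contDiffOn_pullback hU hφ.contDiffOn hφ.injective_fderiv) hx
  have hev : (fun y => nabla m φ (divDifferential m φ) (param m p₀ y) (extend m φ v (param m p₀ y)))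
      =ᶠ[𝓝 x] fun y => -fderiv ℝ (tensionField (chartMap m φ p₀)) y
        (pullback (chartMap m φ p₀) y v) := by
    filter_upwards [hU.mem_nhds hx] with y hy
    rw [nabla_divDifferential_param hφ hy (v := extend m φ v (param m p₀ y))
        (Submodule.starProjection_apply_mem _ _), extend_param hφ hy, pullback_tangentProj (hφ.injective_fderiv y hy)]
  have hd : DifferentiableAt ℝ (fun y => -fderiv ℝ (tensionField (chartMap m φ p₀)) y
        (pullback (chartMap m φ p₀) y v)) x := by fun_prop
  rw [secondNabla, tangentNabla_extend hφ hx hv hv,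
    nabla_divDifferential_param hφ hx (zero_mem _),
    nabla_param (X := fun q => nabla m φ (divDifferential m φ) q (extend m φ v q)) hφ hx
      (hev.differentiableAt_iff.2 hd) hv, hev.fderiv_eq, fderiv_fun_neg]
  simp

lemma fderiv_chartMap_mem (hx : x ∈ paramDomain m p₀) (ζ : EuclideanSpace ℝ (Fin m)) :
    fderiv ℝ (chartMap m φ p₀) x ζ ∈ tangentSpaceIn m φ (param m p₀ x) := by
  rw [tangentSpaceIn_param hφ.contMDiff hx]
  exact ⟨ζ, rfl⟩

lemma inner_sphereProj_fderiv (hx : x ∈ paramDomain m p₀) (v : Ambient n)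
    (ζ : EuclideanSpace ℝ (Fin m)) :
    ⟪sphereProj (chartMap m φ p₀ x) v, fderiv ℝ (chartMap m φ p₀) x ζ⟫_ℝ
      = ⟪v, fderiv ℝ (chartMap m φ p₀) x ζ⟫_ℝ := by
  rw [sphereProj_apply, inner_sub_left, inner_smul_left, inner_chartMap_fderiv hφ hx]
  simp

/-- Constant curvature gives R_{X,e}e = |e|² X - ⟪X, e⟫ e, and X = -τ is normal. -/
lemma inner_curvatureTrace_fderiv (hx : x ∈ paramDomain m p₀) (ζ : EuclideanSpace ℝ (Fin m)) :
    ⟪curvatureTrace m φ (divDifferential m φ) (param m p₀ x), fderiv ℝ (chartMap m φ p₀) x ζ⟫_ℝ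
      = 0 := by
  obtain ⟨e, he⟩ := exists_basis_traceAt hφ hx
  rw [curvatureTrace, he, sum_inner]
  refine Finset.sum_eq_zero fun i _ => ?_
  obtain ⟨ξ, hξ⟩ := (e i).2
  have hξ' : fderiv ℝ (chartMap m φ p₀) x ξ = e i := hξ
  have h1 := inner_chartMap_fderiv hφ hx ξ
  rw [← hξ', divDifferential_param hφ hx]
  change ⟪sphereCurvature (chartMap m φ p₀ x) _ _ _, _⟫_ℝ = 0
  rw [sphereCurvature_eq (norm_chartMap m φ p₀ x) _ h1 h1]
  · simp [inner_smul_left, inner_tensionField_fderiv hφ hx]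
  · rw [real_inner_comm, inner_neg_left, inner_tensionField_chartMap hφ hx, neg_zero]

/-- The relation A_H = |H|² Id with H = τ/m, multiplied by m, turns the factor |H|² into |τ|²/m. -/
lemma tangentProj_fderiv_tensionField (hm : m ≠ 0) (hpu : IsPseudoUmbilical m φ)
    (hx : x ∈ paramDomain m p₀) (ξ : EuclideanSpace ℝ (Fin m)) :
    tangentProj (chartMap m φ p₀) x (fderiv ℝ (tensionField (chartMap m φ p₀)) x ξ)
      = -((‖tensionField (chartMap m φ p₀) x‖ ^ 2 / m) • fderiv ℝ (chartMap m φ p₀) x ξ) := by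
  have hm' : (m : ℝ) ≠ 0 := by exact_mod_cast hm
  have hU := isOpen_paramDomain m p₀
  have dτ := differentiableAt_of_contDiffOn hU (contDiffOn_tensionField hφ) hx
  have hev : (fun y => meanCurvature m φ (param m p₀ y)) =ᶠ[𝓝 x]
      fun y => (m : ℝ)⁻¹ • tensionField (chartMap m φ p₀) y :=
    Filter.mem_of_superset (hU.mem_nhds hx) fun y hy => meanCurvature_param hφ hy
  have hv := fderiv_chartMap_mem hφ hx ξ
  have h := hpu (param m p₀ x) _ hv
  have ha : pullback (chartMap m φ p₀) x (fderiv ℝ (chartMap m φ p₀) x ξ) = ξ :=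
    leftInv_apply (hφ.injective_fderiv x hx) ξ
  rw [weingarten, nabla_param hφ hx (hev.differentiableAt_iff.2 (dτ.fun_const_smul _)) hv, hev.fderiv_eq,
    fderiv_fun_const_smul dτ, ha, meanCurvature_param hφ hx] at h
  simp only [tangentSpaceIn_param hφ.contMDiff hx] at h
  change -tangentProj (chartMap m φ p₀) x _ = _ at h
  rw [tangentProj_sphereProj hφ hx, smul_apply, map_smul, neg_eq_iff_eq_neg] at h
  rw [← smul_right_injective _ (inv_ne_zero hm') |>.eq_iff, h, smul_neg, smul_smul, norm_smul,
    mul_pow]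
  congr 2
  simp
  field_simp

/-- Pair the biharmonic equation with Df ζ: the curvature and index terms are normal, leaving (m/2 -
2) dλ(ζ) = 0. -/
lemma fderiv_norm_sq_tensionField {k : ℝ} (hbi : IsBiharmonicOfIndex m k φ)
    (hpu : IsPseudoUmbilical m φ) (hm : m ≠ 0) (hm4 : m ≠ 4) (hx : x ∈ paramDomain m p₀) :
    fderiv ℝ (fun y => ‖tensionField (chartMap m φ p₀) y‖ ^ 2 / m) x = 0 := by
  obtain ⟨e, he⟩ := exists_basis_traceAt hφ hx
  have hU := isOpen_paramDomain m p₀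
  ext ζ
  have hcore := sum_inner_fderiv_fderiv_pullback hU hφ.contDiffOn hφ.injective_fderiv hx
    (contDiffOn_tensionField hφ) (((contDiffOn_tensionField hφ).norm_sq ℝ).div_const (m : ℝ))
    (fun y hy => tangentProj_tensionField hφ hy)
    (fun y hy ξ => tangentProj_fderiv_tensionField hφ hm hpu hy ξ) e hm (by simp)
    (fun y _ => rfl) (sum_fderiv_tangentProj (hφ.injective_fderiv x hx) e)
    (inner_fderiv_tensionField_chartMap hφ hx) ζ
  have h := congrArg (fun v => ⟪v, fderiv ℝ (chartMap m φ p₀) x ζ⟫_ℝ) (hbi (param m p₀ x))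
  simp only [inner_add_left, inner_sub_left, inner_smul_left, inner_zero_left,
    inner_curvatureTrace_fderiv hφ hx, divDifferential_param hφ hx, inner_neg_left,
    inner_tensionField_fderiv hφ hx, neg_zero, mul_zero, sub_zero, add_zero] at h
  rw [roughLaplacian, traceAt_congr (γ := fun v _ => -sphereProj (chartMap m φ p₀ x) (fderiv ℝ (fun y => fderiv ℝ
      (tensionField (chartMap m φ p₀)) y (pullback (chartMap m φ p₀) y v)) x
        (pullback (chartMap m φ p₀) x v)))
      fun v hv => secondNabla_divDifferential_param hφ hx hv, he,
    inner_neg_left, sum_inner, neg_eq_zero] at h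
  simp only [inner_neg_left, inner_sphereProj_fderiv hφ hx, Finset.sum_neg_distrib] at h
  rw [hcore, neg_eq_zero] at h
  have h4 : (m : ℝ) / 2 - 2 ≠ 0 := by
    intro h0
    exact hm4 (by exact_mod_cast (by linarith : (m : ℝ) = 4))
  exact (mul_eq_zero.1 h).resolve_left h4

lemma isLocallyConstant_norm_meanCurvature {k : ℝ} (hbi : IsBiharmonicOfIndex m k φ)
    (hpu : IsPseudoUmbilical m φ) (hm : m ≠ 0) (hm4 : m ≠ 4) :
    IsLocallyConstant fun p => ‖meanCurvature m φ p‖ := by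
  rw [IsLocallyConstant.iff_eventually_eq]
  intro p₀
  have hU := isOpen_paramDomain m p₀
  have hx₀ : extChartAt (𝓡 m) p₀ p₀ ∈ paramDomain m p₀ := mem_extChartAt_target p₀
  obtain ⟨r, hr, hball⟩ := Metric.isOpen_iff.1 hU _ hx₀
  -- A ball inside the chart domain is connected, so dλ = 0 makes λ constant there.
  have hnhds := (continuousAt_extChartAt (I := 𝓡 m) p₀).preimage_mem_nhds (Metric.ball_mem_nhds _ hr)
  have hm' : (m : ℝ) ≠ 0 := by exact_mod_cast hm
  filter_upwards [hnhds, extChartAt_source_mem_nhds (I := 𝓡 m) p₀] with q hq hqs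
  have hd : DifferentiableOn ℝ (fun y => ‖tensionField (chartMap m φ p₀) y‖ ^ 2 / m)
      (Metric.ball (extChartAt (𝓡 m) p₀ p₀) r) :=
    ((((contDiffOn_tensionField hφ).norm_sq ℝ).div_const (m : ℝ)).differentiableOn
      (by simp)).mono hball
  have hconst := (Metric.isOpen_ball).is_const_of_fderiv_eq_zero
    (convex_ball _ r).isPreconnected hd
    (fun y hy => fderiv_norm_sq_tensionField hφ hbi hpu hm hm4 (hball hy)) hq
    (Metric.mem_ball_self hr)
  beta_reduce at hconst
  rw [div_left_inj' hm', sq_eq_sq₀ (norm_nonneg _) (norm_nonneg _)] at hconst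
  have h1 := meanCurvature_param hφ (hball hq)
  have h2 := meanCurvature_param hφ hx₀
  rw [show param m p₀ (extChartAt (𝓡 m) p₀ q) = q from (extChartAt (𝓡 m) p₀).left_inv hqs] at h1
  rw [show param m p₀ (extChartAt (𝓡 m) p₀ p₀) = p₀ from extChartAt_to_inv p₀] at h2
  rw [h1, h2, norm_smul, norm_smul, hconst]

end SphereSubmanifold
end

theorem mainTheorem8 {m n : ℕ} {M : Type*} [TopologicalSpace M]
    [ChartedSpace (EuclideanSpace ℝ (Fin m)) M] [IsManifold (𝓡 m) ∞ M] [ConnectedSpace M]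
    (φ : M → SphereSubmanifold.UnitSphere n)
    (hφ : ContMDiff (𝓡 m) (𝓡 n) ∞ φ)
    (himm : ∀ p : M, Function.Injective (mfderiv (𝓡 m) (𝓡 n) φ p))
    (k : ℝ) (hbi : SphereSubmanifold.IsBiharmonicOfIndex m k φ)
    (hpu : SphereSubmanifold.IsPseudoUmbilical m φ)
    (hm : m ≠ 4) :
    ∃ c : ℝ, ∀ p : M, ‖SphereSubmanifold.meanCurvature m φ p‖ = c := by
  rcases eq_or_ne m 0 with rfl | hm0
  -- In dimension 0 the factor `m⁻¹` is 0 by convention, so H = 0; the chart argument needs to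
  -- divide by m.
  · exact ⟨0, fun p => by simp [SphereSubmanifold.meanCurvature]⟩
  · obtain ⟨p₀⟩ := (inferInstance : Nonempty M)
    exact ⟨_, fun p => (SphereSubmanifold.isLocallyConstant_norm_meanCurvature ⟨hφ, himm⟩ hbi hpu
      hm0 hm).apply_eq_of_preconnectedSpace p p₀⟩
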